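/- **Setting.** Let $n\ge 1$, $k\ge 0$ be integers, $\mathcal S=\{1,\dots,n\}$, $\mathcal P=\{q\in[0,1]^n:\sum_i q_i=1\}$. Let $\mathcal W$ be a measurable space and $\mathcal A_1,\dots,\mathcal A_n$ standard Borel spaces. For $i,j\in\mathcal S$, $l\in\{0,\dots,k\}$ let $c_{i,l}:\mathcal W\times\mathcal A_i\to[-c_{\max},c_{\max}]$ and $p_{i,j}:\mathcal W\times\mathcal A_i\to[0,1]$ be measurable, with $c_{\max}<\infty$ and $\sum_j p_{i,j}(w,a)=1$ for all $i,w,a$. On a probability space let $W(t),U(t),V(t)$, $t=0,1,2,\dots$, be mutually independent random elements, the $W(t)$ identically distributed in $\mathcal W$, and the $U(t)$ and $V(t)$ uniform on $[0,1]$. Let $\psi:\mathcal P\times[0,1]\to\mathcal S$ be measurable such that $\psi(q,V)$ has mass function $q$ for every $q\in\mathcal P$ when $V\sim\mathrm{Unif}[0,1]$. A *causal and measurable policy* is a sequence of measurable maps $\alpha_t:\mathcal W\times[0,1]\times(\mathcal S^t\times\mathcal W^t\times[0,1]^t)\to\mathcal A_1\times\cdots\times\mathcal A_n$, $t\ge0$.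 Together with an initial state $s_0\in\mathcal S$ it determines $S(0)=s_0$, the history $H(t)=(S(0),\dots,S(t-1),W(0),\dots,W(t-1),U(0),\dots,U(t-1))$, the actions $A(t)=(A_1(t),\dots,A_n(t))=\alpha_t(W(t),U(t),H(t))$, the next state $S(t+1)=\psi\big((p_{i,j}(W(t),A_i(t)))_{j\in\mathcal S},V(t)\big)$ on $\{S(t)=i\}$, and the costs $C_l(t)=\sum_{i}1_{\{S(t)=i\}}c_{i,l}(W(t),A_i(t))$. The *stochastic problem is feasible from $s_0$* if some causal and measurable policy satisfies, almost surely, $$\limsup_{T\to\infty}\frac1T\sum_{t=0}^{T-1}C_l(t)\le 0\qquad\text{for all } l\in\{1,\dots,k\}.\tag{1}$$ For $i\in\mathcal S$ let $\Gamma_i\subseteq\mathbb R^{k+1}\times\mathbb R^{n}$ be the set of all vectors $\big((\mathbb E[c_{i,l}(W(0),a(W(0),U(0)))])_{l};(\mathbb E[p_{i,j}(W(0),a(W(0),U(0)))])_{j}\big)$ with $a:\mathcal W\times[0,1]\to\mathcal A_i$ measurable, and $\overline\Gamma_i$ its closure. The *deterministic problem*, in the variables $\pi_i$, $c_{i,l}$,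 $p_{i,j}$, is to minimize $\sum_i\pi_ic_{i,0}$ subject to $\pi_j=\sum_i\pi_ip_{i,j}$ for all $j\in\mathcal S$; $\sum_i\pi_ic_{i,l}\le0$ for all $l\in\{1,\dots,k\}$; $(\pi_1,\dots,\pi_n)\in\mathcal P$; and $\big((c_{i,l})_l;(p_{i,j})_j\big)\in\overline\Gamma_i$ for all $i\in\mathcal S$. It is *feasible* if these constraints can be satisfied; then $c_0^*$ denotes the infimum of its objective over all points satisfying them. **Theorem (Converse).** Suppose the stochastic problem is feasible from $s_0\in\mathcal S$. Then the deterministic problem is feasible. Moreover, for every causal and measurable policy which, started from $S(0)=s_0$, satisfies (1) almost surely, $$\liminf_{T\to\infty}\frac1T\sum_{t=0}^{T-1}C_0(t)\ \ge\ c_0^*\quad\text{almost surely},\qquad\text{and}\qquad \liminf_{T\to\infty}\frac1T\sum_{t=0}^{T-1}\mathbb E[C_0(t)]\ \ge\ c_0^*.$$ -/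

import Mathlib

open MeasureTheory ProbabilityTheory Filter

namespace OppMDP

universe uΩ uW uA

/-- Data of an opportunistic Markov decision problem with basic states `Fin n`, random elements
valued in `𝓦`, action sets `𝓐 i`, objective cost `0 : Fin (k + 1)` and constraint costs
`l.succ` for `l : Fin k`. -/
structure Model (n k : ℕ) (𝓦 : Type uW) [MeasurableSpace 𝓦]
    (𝓐 : Fin n → Type uA) [∀ i, MeasurableSpace (𝓐 i)] where
  /-- the uniform bound on the costs -/
  cmax : ℝ
  /-- the cost functions `c_{i,l}(w, a)` -/
  cost : (i : Fin n) → Fin (k + 1) → 𝓦 → 𝓐 i → ℝ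
  /-- the transition probability functions `p_{i,j}(w, a)` -/
  prob : (i : Fin n) → Fin n → 𝓦 → 𝓐 i → ℝ
  measurable_cost : ∀ i l, Measurable (fun x : 𝓦 × 𝓐 i => cost i l x.1 x.2)
  abs_cost_le : ∀ i l w a, |cost i l w a| ≤ cmax
  measurable_prob : ∀ i j, Measurable (fun x : 𝓦 × 𝓐 i => prob i j x.1 x.2)
  prob_nonneg : ∀ i j w a, 0 ≤ prob i j w a
  sum_prob : ∀ i w a, ∑ j, prob i j w a = 1

/-- A measurable map `ψ` such that `ψ(q, V)` has mass function `q` when `V ~ Unif[0,1]`. -/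
structure Sampler (n : ℕ) where
  /-- the map `ψ` -/
  toFun : stdSimplex ℝ (Fin n) → unitInterval → Fin n
  measurable_toFun : Measurable (fun x : stdSimplex ℝ (Fin n) × unitInterval => toFun x.1 x.2)
  volume_eq : ∀ (q : stdSimplex ℝ (Fin n)) (j : Fin n),
    volume {v : unitInterval | toFun q v = j} = ENNReal.ofReal (q.1 j)

/-- The driving randomness: `W(t)` i.i.d. in `𝓦`, `U(t)` i.i.d. `Unif[0,1]`, `V(t)` i.i.d.
`Unif[0,1]`, with all the variables `W(0), W(1), …, U(0), U(1), …, V(0), V(1), …`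
mutually independent. -/
structure Noise {Ω : Type uΩ} [MeasurableSpace Ω] (P : Measure Ω)
    (𝓦 : Type uW) [MeasurableSpace 𝓦] where
  W : ℕ → Ω → 𝓦
  U : ℕ → Ω → unitInterval
  V : ℕ → Ω → unitInterval
  measurable_W : ∀ t, Measurable (W t)
  measurable_U : ∀ t, Measurable (U t)
  measurable_V : ∀ t, Measurable (V t)
  identDistrib_W : ∀ t, IdentDistrib (W t) (W 0) P P
  map_U : ∀ t, P.map (U t) = volume
  map_V : ∀ t, P.map (V t) = volume
  indep : iIndep
    (Sum.elim (fun t => MeasurableSpace.comap (W t) inferInstance)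
      (Sum.elim (fun t => MeasurableSpace.comap (U t) inferInstance)
        (fun t => MeasurableSpace.comap (V t) inferInstance)) :
      ℕ ⊕ ℕ ⊕ ℕ → MeasurableSpace Ω) P

/-- The values of the history before slot `t`: the past states `S(0), …, S(t-1)`, the past
`W(0), …, W(t-1)` and the past `U(0), …, U(t-1)` (a one-point space for `t = 0`). -/
abbrev Hist (n : ℕ) (𝓦 : Type uW) (t : ℕ) : Type uW :=
  (Fin t → Fin n) × (Fin t → 𝓦) × (Fin t → unitInterval)

/-- A causal and measurable policy: measurable maps
`α_t : 𝓦 × [0,1] × D_H(t) → 𝓐_1 × ⋯ × 𝓐_n`. -/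
structure Policy (n : ℕ) (𝓦 : Type uW) [MeasurableSpace 𝓦]
    (𝓐 : Fin n → Type uA) [∀ i, MeasurableSpace (𝓐 i)] where
  /-- the map `α_t` -/
  act : (t : ℕ) → 𝓦 × unitInterval × Hist n 𝓦 t → ((i : Fin n) → 𝓐 i)
  measurable_act : ∀ t, Measurable (act t)

section

variable {n k : ℕ} {𝓦 : Type uW} [MeasurableSpace 𝓦]
  {𝓐 : Fin n → Type uA} [∀ i, MeasurableSpace (𝓐 i)]
  {Ω : Type uΩ} [MeasurableSpace Ω] {P : Measure Ω}

/-- The mass function `(p_{i,1}(w, a), …, p_{i,n}(w, a))`. -/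
def Model.row (M : Model n k 𝓦 𝓐) (i : Fin n) (w : 𝓦) (a : 𝓐 i) : stdSimplex ℝ (Fin n) :=
  ⟨fun j => M.prob i j w a, fun j => M.prob_nonneg i j w a, M.sum_prob i w a⟩

/-- The basic state `S(t)` under a policy: `S(0) = s₀`, and, when `S(t) = i`,
`S(t+1) = ψ((p_{i,j}(W(t), A_i(t)))_j, V(t))` with `A(t) = α_t(W(t), U(t), H(t))`. -/
def state (M : Model n k 𝓦 𝓐) (ψ : Sampler n) (N : Noise P 𝓦) (s₀ : Fin n)
    (α : Policy n 𝓦 𝓐) : ℕ → Ω → Fin n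
  | 0, _ => s₀
  | t + 1, ω =>
    ψ.toFun
      (M.row (state M ψ N s₀ α t ω) (N.W t ω)
        (α.act t (N.W t ω, N.U t ω,
          (fun r : Fin t => state M ψ N s₀ α r.1 ω, fun r => N.W r.1 ω, fun r => N.U r.1 ω))
          (state M ψ N s₀ α t ω)))
      (N.V t ω)
  termination_by t => t
  decreasing_by all_goals omega

/-- The history `H(t)`. -/
def history (M : Model n k 𝓦 𝓐) (ψ : Sampler n) (N : Noise P 𝓦) (s₀ : Fin n)
    (α : Policy n 𝓦 𝓐) (t : ℕ) (ω : Ω) : Hist n 𝓦 t :=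
  (fun r => state M ψ N s₀ α r.1 ω, fun r => N.W r.1 ω, fun r => N.U r.1 ω)

/-- The action vector `A(t) = α_t(W(t), U(t), H(t))`. -/
def action (M : Model n k 𝓦 𝓐) (ψ : Sampler n) (N : Noise P 𝓦) (s₀ : Fin n)
    (α : Policy n 𝓦 𝓐) (t : ℕ) (ω : Ω) : (i : Fin n) → 𝓐 i :=
  α.act t (N.W t ω, N.U t ω, history M ψ N s₀ α t ω)

theorem state_zero (M : Model n k 𝓦 𝓐) (ψ : Sampler n) (N : Noise P 𝓦) (s₀ : Fin n)
    (α : Policy n 𝓦 𝓐) (ω : Ω) : state M ψ N s₀ α 0 ω = s₀ := by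
  rw [state]

theorem state_succ (M : Model n k 𝓦 𝓐) (ψ : Sampler n) (N : Noise P 𝓦) (s₀ : Fin n)
    (α : Policy n 𝓦 𝓐) (t : ℕ) (ω : Ω) :
    state M ψ N s₀ α (t + 1) ω =
      ψ.toFun (M.row (state M ψ N s₀ α t ω) (N.W t ω)
        (action M ψ N s₀ α t ω (state M ψ N s₀ α t ω))) (N.V t ω) := by
  rw [state]; rfl

/-- The cost `C_l(t) = ∑_i 1_{S(t) = i} c_{i,l}(W(t), A_i(t))`. -/
noncomputable def costProc (M : Model n k 𝓦 𝓐) (ψ : Sampler n) (N : Noise P 𝓦) (s₀ : Fin n)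
    (α : Policy n 𝓦 𝓐) (l : Fin (k + 1)) (t : ℕ) (ω : Ω) : ℝ :=
  ∑ i, if state M ψ N s₀ α t ω = i then
    M.cost i l (N.W t ω) (action M ψ N s₀ α t ω i) else 0

/-- `(1/T) ∑_{t<T} x_t`. -/
noncomputable def timeAvg (x : ℕ → ℝ) (T : ℕ) : ℝ :=
  (1 / (T : ℝ)) * ∑ t ∈ Finset.range T, x t

/-- The policy satisfies, almost surely, all the constraints
`limsup_T (1/T) ∑_{t<T} C_l(t) ≤ 0`, `l = 1, …, k`. -/
def SatisfiesConstraints (M : Model n k 𝓦 𝓐) (ψ : Sampler n) (N : Noise P 𝓦) (s₀ : Fin n)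
    (α : Policy n 𝓦 𝓐) : Prop :=
  ∀ᵐ ω ∂P, ∀ l : Fin k,
    limsup (timeAvg fun t => costProc M ψ N s₀ α l.succ t ω) atTop ≤ 0

/-- The stochastic problem is feasible from the initial state `s₀`. -/
def StochasticFeasible (M : Model n k 𝓦 𝓐) (ψ : Sampler n) (N : Noise P 𝓦) (s₀ : Fin n) :
    Prop :=
  ∃ α : Policy n 𝓦 𝓐, SatisfiesConstraints M ψ N s₀ α

/-- The set `Γ_i` of all vectors `E[g_i(W(0), α_i(W(0), U(0)))]`,
`g_i = ((c_{i,l})_l ; (p_{i,j})_j)`, over measurable `α_i : 𝓦 × [0,1] → 𝓐_i`. -/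
def Gam (M : Model n k 𝓦 𝓐) (N : Noise P 𝓦) (i : Fin n) :
    Set ((Fin (k + 1) → ℝ) × (Fin n → ℝ)) :=
  {x | ∃ a : 𝓦 × unitInterval → 𝓐 i, Measurable a ∧
    x = (fun l => ∫ ω, M.cost i l (N.W 0 ω) (a (N.W 0 ω, N.U 0 ω)) ∂P,
         fun j => ∫ ω, M.prob i j (N.W 0 ω) (a (N.W 0 ω, N.U 0 ω)) ∂P)}

/-- The decision variables `(π_i)`, `(c_{i,l})`, `(p_{i,j})` of the deterministic problem. -/
structure DetVar (n k : ℕ) where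
  π : Fin n → ℝ
  c : Fin n → Fin (k + 1) → ℝ
  p : Fin n → Fin n → ℝ

/-- The objective `∑_i π_i c_{i,0}`. -/
def DetVar.objective (x : DetVar n k) : ℝ := ∑ i, x.π i * x.c i 0

/-- The constraints of the deterministic problem. -/
structure DetVar.IsFeasible (x : DetVar n k) (M : Model n k 𝓦 𝓐) (N : Noise P 𝓦) : Prop where
  balance : ∀ j, x.π j = ∑ i, x.π i * x.p i j
  cost_le : ∀ l : Fin k, ∑ i, x.π i * x.c i l.succ ≤ 0
  mem_simplex : x.π ∈ stdSimplex ℝ (Fin n)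
  mem_closure : ∀ i, (x.c i, x.p i) ∈ closure (Gam M N i)

/-- The deterministic problem is feasible. -/
def DetFeasible (M : Model n k 𝓦 𝓐) (N : Noise P 𝓦) : Prop :=
  ∃ x : DetVar n k, x.IsFeasible M N

/-- The infimum objective value `c_0^*` of the deterministic problem (a genuine infimum when the
problem is feasible, since the objective is then bounded below by `-c_max`). -/
noncomputable def optCost (M : Model n k 𝓦 𝓐) (N : Noise P 𝓦) : ℝ :=
  sInf {r | ∃ x : DetVar n k, x.IsFeasible M N ∧ r = x.objective}

end

end OppMDP

namespace OppMDP

open Topology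

universe uΩ uW uA

-- Time averages of bounded real sequences

section TimeAverages

-- With the history frozen, a policy picks in state $i$ a rule depending only on $(W(t),U(t))$; its
-- mean vector $\gamma_i(t)$ lies in $\Gamma_i$. Fresh noise is independent of the past, so, given
-- the past, $C_l(t)$ and $1_{\{S(t+1)=j\}}$ have as means the entries of $\gamma_{S(t)}(t)$. The
-- deviations from these means are bounded and orthogonal, hence average out to zero almost surely,
-- whatever the policy does (`Noise.ae_tendsto_timeAvg`).
--
-- The rest happens on one typical path (`exists_detVar_of_path`). Grouping slots by state, the
-- average of $\gamma_{S(t)}(t)$ over $t<T$ becomes $\sum_i f_i(T)\,x_i(T)$, where $f_i(T)$ is the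
-- frequency of $i$ and, by convexity (`convex_Gam`), $x_i(T)\in\overline\Gamma_i$. Frequencies and
-- averages range over compact sets, so they converge together along an ultrafilter of times at
-- which the average of $C_0$ is below a given $b>\liminf$. The limit is feasible: the cost
-- constraints pass to the limit, and balance holds because shifting time by one slot does not alter
-- limiting frequencies. Its objective is at most $b$, and $b$ may approach the lower limit.
--
-- Boundedness then turns the almost sure bound into one on expectations
-- (`le_liminf_integral_of_ae_le_liminf`).

theorem abs_sum_range_le {x : ℕ → ℝ} {C : ℝ} (hx : ∀ t, |x t| ≤ C) (T : ℕ) :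
    |∑ t ∈ Finset.range T, x t| ≤ T * C :=
  (Finset.abs_sum_le_sum_abs _ _).trans <|
    (Finset.sum_le_sum fun t _ => hx t).trans (by simp)

theorem abs_timeAvg_le {x : ℕ → ℝ} {C : ℝ} (hx : ∀ t, |x t| ≤ C) (T : ℕ) :
    |timeAvg x T| ≤ C := by
  have hC : 0 ≤ C := (abs_nonneg _).trans (hx 0)
  rcases Nat.eq_zero_or_pos T with rfl | hT
  · simpa [timeAvg] using hC
  · have hT' : (0 : ℝ) < T := by exact_mod_cast hT
    rw [timeAvg, one_div, abs_mul, abs_inv, Nat.abs_cast, inv_mul_le_iff₀ hT']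
    exact abs_sum_range_le hx T

theorem timeAvg_sub (x y : ℕ → ℝ) (T : ℕ) :
    timeAvg (fun t => x t - y t) T = timeAvg x T - timeAvg y T := by
  simp [timeAvg, Finset.sum_sub_distrib, mul_sub]

theorem isBoundedUnder_le_of_abs_le {x : ℕ → ℝ} {C : ℝ} (hx : ∀ T, |x T| ≤ C) :
    IsBoundedUnder (· ≤ ·) atTop x :=
  isBoundedUnder_of ⟨C, fun T => (abs_le.1 (hx T)).2⟩

theorem isBoundedUnder_ge_of_abs_le {x : ℕ → ℝ} {C : ℝ} (hx : ∀ T, |x T| ≤ C) :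
    IsBoundedUnder (· ≥ ·) atTop x :=
  isBoundedUnder_of ⟨-C, fun T => (abs_le.1 (hx T)).1⟩

/-- Shifting a bounded sequence by one step does not change its time averages in the limit. -/
theorem tendsto_timeAvg_succ_sub {x : ℕ → ℝ} {C : ℝ} (hx : ∀ t, |x t| ≤ C) :
    Tendsto (fun T => timeAvg (fun t => x (t + 1)) T - timeAvg x T) atTop (𝓝 0) := by
  have h0 : Tendsto (fun T : ℕ => (2 * C) * (1 / (T : ℝ))) atTop (𝓝 0) := by
    simpa using (tendsto_one_div_atTop_nhds_zero_nat (𝕜 := ℝ)).const_mul (2 * C)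
  refine squeeze_zero_norm (fun T => ?_) h0
  have h : timeAvg (fun t => x (t + 1)) T - timeAvg x T = (1 / (T : ℝ)) * (x T - x 0) := by
    rw [← timeAvg_sub, timeAvg, Finset.sum_range_sub]
  rw [h, Real.norm_eq_abs, abs_mul, abs_of_nonneg (by positivity : (0 : ℝ) ≤ 1 / T), mul_comm]
  refine mul_le_mul_of_nonneg_right ?_ (by positivity)
  have := abs_sub (x T) (x 0)
  linarith [hx T, hx 0]

end TimeAverages

-- A strong law for bounded orthogonal variables

section Orthogonal

variable {Ω : Type*} [MeasurableSpace Ω] {P : Measure Ω} [IsProbabilityMeasure P]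

/-- Orthogonality removes the cross terms, so the second moment grows linearly in $T$ and that of
the time average decays like $1/T$. -/
theorem integral_sq_sum_range_le {X : ℕ → Ω → ℝ} {C : ℝ} (hX : ∀ t, Measurable (X t))
    (hC : ∀ t ω, |X t ω| ≤ C) (horth : ∀ s t, s < t → ∫ ω, X s ω * X t ω ∂P = 0) (T : ℕ) :
    ∫ ω, (∑ t ∈ Finset.range T, X t ω) ^ 2 ∂P ≤ T * C ^ 2 := by
  have hint : ∀ (f : Ω → ℝ) (B : ℝ), Measurable f → (∀ ω, |f ω| ≤ B) → Integrable f P :=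
    fun f B hf hB => Integrable.of_bound hf.aestronglyMeasurable B (ae_of_all _ hB)
  have hXX : ∀ s t, Integrable (fun ω => X s ω * X t ω) P := fun s t =>
    hint _ (C * C) ((hX s).mul (hX t)) fun ω => by
      rw [abs_mul]
      exact mul_le_mul (hC s ω) (hC t ω) (abs_nonneg _) ((abs_nonneg _).trans (hC s ω))
  have hS : ∀ T, Measurable fun ω => ∑ t ∈ Finset.range T, X t ω := fun T =>
    Finset.measurable_sum _ fun t _ => hX t
  induction T with
  | zero => simp
  | succ T ih =>
    have hcross : ∫ ω, (∑ t ∈ Finset.range T, X t ω) * X T ω ∂P = 0 := by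
      simp_rw [Finset.sum_mul]
      rw [integral_finsetSum _ fun s _ => hXX s T]
      exact Finset.sum_eq_zero fun s hs => horth s T (Finset.mem_range.1 hs)
    have hi1 : Integrable (fun ω => (∑ t ∈ Finset.range T, X t ω) ^ 2) P :=
      hint _ ((T * C) ^ 2) ((hS T).pow_const 2) fun ω => by
        rw [abs_pow]
        exact pow_le_pow_left₀ (abs_nonneg _) (abs_sum_range_le (fun t => hC t ω) T) 2
    have hi2 : Integrable (fun ω => (∑ t ∈ Finset.range T, X t ω) * X T ω) P := by
      simp_rw [Finset.sum_mul]
      exact integrable_finsetSum _ fun s _ => hXX s T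
    have hi3 : Integrable (fun ω => X T ω * X T ω) P := hXX T T
    have hexp : ∀ ω, (∑ t ∈ Finset.range (T + 1), X t ω) ^ 2 =
        (∑ t ∈ Finset.range T, X t ω) ^ 2 + 2 * ((∑ t ∈ Finset.range T, X t ω) * X T ω)
          + X T ω * X T ω := fun ω => by rw [Finset.sum_range_succ]; ring
    simp_rw [hexp]
    have hi12 : Integrable (fun ω => (∑ t ∈ Finset.range T, X t ω) ^ 2 +
        2 * ((∑ t ∈ Finset.range T, X t ω) * X T ω)) P := hi1.add (hi2.const_mul 2)
    rw [integral_add hi12 hi3, integral_add hi1 (hi2.const_mul 2), integral_const_mul, hcross]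
    have h3 : ∫ ω, X T ω * X T ω ∂P ≤ C ^ 2 := by
      have := integral_mono hi3 (integrable_const (C ^ 2)) fun ω => by
        change X T ω * X T ω ≤ C ^ 2
        nlinarith [abs_le.1 (hC T ω)]
      simpa using this
    push_cast
    linarith

/-- Strong law of large numbers for uniformly bounded, pairwise orthogonal random variables. -/
theorem ae_tendsto_timeAvg_of_orthogonal {X : ℕ → Ω → ℝ} {C : ℝ} (hX : ∀ t, Measurable (X t))
    (hC : ∀ t ω, |X t ω| ≤ C) (horth : ∀ s t, s < t → ∫ ω, X s ω * X t ω ∂P = 0) :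
    ∀ᵐ ω ∂P, Tendsto (timeAvg fun t => X t ω) atTop (𝓝 0) := by
  have hmeas : ∀ T, Measurable fun ω => timeAvg (fun t => X t ω) T := fun T =>
    (Finset.measurable_sum _ fun t _ => hX t).const_mul _
  -- Second moments of order $1/T$ are not summable over all $T$, but they are along the squares
  -- $T=m^2$.
  have hbound : ∀ m : ℕ, ∫⁻ ω, ENNReal.ofReal ((timeAvg (fun t => X t ω) (m ^ 2)) ^ 2) ∂P ≤
      ENNReal.ofReal (C ^ 2 * (1 / (m : ℝ) ^ 2)) := by
    intro m
    rw [← ofReal_integral_eq_lintegral_ofReal]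
    · refine ENNReal.ofReal_le_ofReal ?_
      simp_rw [timeAvg, mul_pow]
      rw [integral_const_mul]
      refine (mul_le_mul_of_nonneg_left (integral_sq_sum_range_le hX hC horth (m ^ 2))
        (by positivity)).trans_eq ?_
      rcases Nat.eq_zero_or_pos m with rfl | hm
      · simp
      · have : (m : ℝ) ≠ 0 := by positivity
        push_cast
        field_simp
    · refine Integrable.of_bound ((hmeas _).pow_const 2).aestronglyMeasurable (C ^ 2)
        (ae_of_all _ fun ω => ?_)
      rw [Real.norm_eq_abs, abs_pow]
      exact pow_le_pow_left₀ (abs_nonneg _) (abs_timeAvg_le (fun t => hC t ω) _) 2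
    · exact ae_of_all _ fun ω => sq_nonneg _
  have hsum : ∫⁻ ω, ∑' m : ℕ, ENNReal.ofReal ((timeAvg (fun t => X t ω) (m ^ 2)) ^ 2) ∂P ≠ ⊤ := by
    rw [lintegral_tsum fun m => (((hmeas _).pow_const 2).ennreal_ofReal).aemeasurable]
    refine ne_top_of_le_ne_top ?_ (ENNReal.tsum_le_tsum hbound)
    have hs : Summable fun m : ℕ => C ^ 2 * (1 / (m : ℝ) ^ 2) :=
      (Real.summable_one_div_nat_pow.2 one_lt_two).mul_left _
    exact hs.tsum_ofReal_ne_top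
  filter_upwards [ae_lt_top (by
    exact Measurable.tsum fun m => ((hmeas _).pow_const 2).ennreal_ofReal) hsum] with ω hω
  have h1 := ENNReal.tendsto_atTop_zero_of_tsum_ne_top hω.ne
  have h2 : Tendsto (fun m : ℕ => |timeAvg (fun t => X t ω) (m ^ 2)|) atTop (𝓝 0) := by
    have := (ENNReal.tendsto_toReal ENNReal.zero_ne_top).comp h1
    simp only [Function.comp_def, ENNReal.toReal_zero] at this
    have h3 := (Real.continuous_sqrt.tendsto 0).comp this
    simpa [Function.comp_def, ENNReal.toReal_ofReal (sq_nonneg _), Real.sqrt_sq_eq_abs] using h3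
  have hsqrt : Tendsto Nat.sqrt atTop atTop :=
    tendsto_atTop_atTop.2 fun b => ⟨b ^ 2, fun a ha => Nat.le_sqrt'.2 ha⟩
  have h4 : Tendsto (fun m : ℕ => |timeAvg (fun t => X t ω) (m ^ 2)| + 2 * C * (1 / (m : ℝ)))
      atTop (𝓝 0) := by
    simpa using h2.add ((tendsto_one_div_atTop_nhds_zero_nat (𝕜 := ℝ)).const_mul (2 * C))
  -- For $m^2\le T<(m+1)^2$ at most $2m$ further terms occur; after division by $m^2$ they
  -- contribute at most $2C/m$.
  refine squeeze_zero_norm' ?_ (h4.comp hsqrt)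
  filter_upwards [eventually_ge_atTop 1] with T hT
  have hC0 : 0 ≤ C := (abs_nonneg _).trans (hC 0 ω)
  obtain ⟨m, hm⟩ : ∃ m, Nat.sqrt T = m := ⟨_, rfl⟩
  have hm1 : m ^ 2 ≤ T := hm ▸ Nat.sqrt_le' T
  have hm2 : T < (m + 1) ^ 2 := hm ▸ Nat.lt_succ_sqrt' T
  have hm0 : 1 ≤ m := by
    rw [← hm]; exact Nat.le_sqrt'.2 (by simpa using hT)
  simp only [Function.comp, hm]
  have hsplit : ∑ t ∈ Finset.range T, X t ω =
      ∑ t ∈ Finset.range (m ^ 2), X t ω + ∑ t ∈ Finset.range (T - m ^ 2), X (m ^ 2 + t) ω := by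
    rw [← Finset.sum_range_add]; congr 2; omega
  have hm2R : (T : ℝ) < (m + 1) ^ 2 := by exact_mod_cast hm2
  have hm1R : (m : ℝ) ^ 2 ≤ T := by exact_mod_cast hm1
  have hm0R : (1 : ℝ) ≤ m := by exact_mod_cast hm0
  have hT0 : (0 : ℝ) < T := by exact_mod_cast hT
  have hrest : |∑ t ∈ Finset.range (T - m ^ 2), X (m ^ 2 + t) ω| ≤ 2 * m * C := by
    refine (abs_sum_range_le (fun t => hC _ ω) _).trans (mul_le_mul_of_nonneg_right ?_ hC0)
    have : T - m ^ 2 ≤ 2 * m := by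
      have : (m + 1) ^ 2 = m ^ 2 + 2 * m + 1 := by ring
      omega
    exact_mod_cast this
  have hle : 1 / (T : ℝ) ≤ 1 / (m : ℝ) ^ 2 := one_div_le_one_div_of_le (by positivity) hm1R
  rw [Real.norm_eq_abs, timeAvg, hsplit, abs_mul, abs_of_nonneg (by positivity : (0 : ℝ) ≤ 1 / T),
    timeAvg, abs_mul, Nat.cast_pow, abs_of_nonneg (by positivity : (0 : ℝ) ≤ 1 / (m : ℝ) ^ 2)]
  calc 1 / (T : ℝ) * |∑ t ∈ Finset.range (m ^ 2), X t ω +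
        ∑ t ∈ Finset.range (T - m ^ 2), X (m ^ 2 + t) ω|
      ≤ 1 / (m : ℝ) ^ 2 * (|∑ t ∈ Finset.range (m ^ 2), X t ω| + 2 * m * C) := by
        refine mul_le_mul hle ((abs_add_le _ _).trans ?_) (abs_nonneg _) (by positivity)
        gcongr
    _ = _ := by
        have : (m : ℝ) ≠ 0 := by positivity
        field_simp

end Orthogonal

-- Limit points along a single path

section Pathwise

variable {n k : ℕ}

/-- The empirical frequency of the value `i` among the first `T` terms of `s`. -/
noncomputable def freq (s : ℕ → Fin n) (T : ℕ) (i : Fin n) : ℝ :=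
  timeAvg (fun t => if s t = i then 1 else 0) T

theorem freq_nonneg (s : ℕ → Fin n) (T : ℕ) (i : Fin n) : 0 ≤ freq s T i :=
  mul_nonneg (by positivity) (Finset.sum_nonneg fun t _ => by positivity)

theorem sum_freq (s : ℕ → Fin n) {T : ℕ} (hT : 1 ≤ T) : ∑ i, freq s T i = 1 := by
  have : (T : ℝ) ≠ 0 := by positivity
  simp only [freq, timeAvg]
  rw [← Finset.mul_sum, Finset.sum_comm]
  simp [this]

/-- Averaging a sequence of a convex set over the times at which `s` visits `i` gives a point of
the convex set. -/
theorem exists_mem_freq_smul_eq {E : Type*} [AddCommGroup E] [Module ℝ E] {K : Set E}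
    (hK : Convex ℝ K) (s : ℕ → Fin n) (i : Fin n) {γ : ℕ → E} (hγ : ∀ t, γ t ∈ K) (T : ℕ) :
    ∃ x ∈ K, freq s T i • x =
      (1 / (T : ℝ)) • ∑ t ∈ Finset.range T, (if s t = i then (1 : ℝ) else 0) • γ t := by
  set w : ℕ → ℝ := fun t => if s t = i then 1 else 0 with hw
  have hw0 : ∀ t, 0 ≤ w t := fun t => by simp only [hw]; positivity
  have hsum0 : 0 ≤ ∑ t ∈ Finset.range T, w t := Finset.sum_nonneg fun t _ => hw0 t
  rcases hsum0.eq_or_lt with h | h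
  · have hz : ∀ t ∈ Finset.range T, w t = 0 :=
      (Finset.sum_eq_zero_iff_of_nonneg fun t _ => hw0 t).1 h.symm
    -- The state $i$ is not visited before $T$: its weight is zero and any point of `K` will do.
    refine ⟨γ 0, hγ 0, ?_⟩
    rw [Finset.sum_eq_zero fun t ht =>
      (congrArg (· • γ t) (hz t ht)).trans (zero_smul ℝ _)]
    have : freq s T i = 0 := by
      simp only [freq, timeAvg]
      rw [Finset.sum_eq_zero hz, mul_zero]
    simp [this]
  · refine ⟨(Finset.range T).centerMass w γ,
      hK.centerMass_mem (fun t _ => hw0 t) h fun t _ => hγ t, ?_⟩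
    rw [Finset.centerMass, smul_smul]
    congr 1
    simp only [freq, timeAvg]
    rw [mul_assoc, mul_inv_cancel₀ h.ne', mul_one]

/-- The long-run averages along one path produce a feasible point of the deterministic problem. -/
theorem exists_detVar_of_path {K : Fin n → Set ((Fin (k + 1) → ℝ) × (Fin n → ℝ))}
    (hKc : ∀ i, IsCompact (K i)) (hKx : ∀ i, Convex ℝ (K i)) {s : ℕ → Fin n}
    {γ : Fin n → ℕ → (Fin (k + 1) → ℝ) × (Fin n → ℝ)} (hγ : ∀ i t, γ i t ∈ K i)
    {c : Fin (k + 1) → ℕ → ℝ} {C : ℝ} (hC : ∀ l t, |c l t| ≤ C)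
    (hcost : ∀ l, Tendsto (timeAvg fun t => c l t - (γ (s t) t).1 l) atTop (𝓝 0))
    (hprob : ∀ j, Tendsto (timeAvg fun t => (if s (t + 1) = j then 1 else 0) - (γ (s t) t).2 j)
      atTop (𝓝 0))
    (hcon : ∀ l : Fin k, limsup (timeAvg (c l.succ)) atTop ≤ 0)
    {b : ℝ} (hb : liminf (timeAvg (c 0)) atTop < b) :
    ∃ x : DetVar n k, (∀ j, x.π j = ∑ i, x.π i * x.p i j) ∧
      (∀ l : Fin k, ∑ i, x.π i * x.c i l.succ ≤ 0) ∧ x.π ∈ stdSimplex ℝ (Fin n) ∧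
      (∀ i, (x.c i, x.p i) ∈ K i) ∧ x.objective ≤ b := by
  have hfreq : ∃ᶠ T in atTop, timeAvg (c 0) T < b :=
    frequently_lt_of_liminf_lt
      (isBoundedUnder_le_of_abs_le (abs_timeAvg_le (hC 0))).isCoboundedUnder_ge hb
  -- An ultrafilter replaces successive extraction of subsequences: every family with values in a
  -- compact set converges along it, and the bound `b` holds along it too.
  have hne : NeBot (atTop ⊓ 𝓟 {T : ℕ | timeAvg (c 0) T < b}) := frequently_mem_iff_neBot.1 hfreq
  obtain ⟨𝒰, h𝒰⟩ := Ultrafilter.exists_le (atTop ⊓ 𝓟 {T : ℕ | timeAvg (c 0) T < b})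
  have h𝒰top : (𝒰 : Filter ℕ) ≤ atTop := h𝒰.trans inf_le_left
  have h𝒰b : ∀ᶠ T in (𝒰 : Filter ℕ), timeAvg (c 0) T < b :=
    h𝒰 (mem_inf_of_right (mem_principal_self _))
  choose x hxK hx using fun (i : Fin n) (T : ℕ) => exists_mem_freq_smul_eq (hKx i) s i (hγ i) T
  have hx1 : ∀ T l, ∑ i, freq s T i * (x i T).1 l = timeAvg (fun t => (γ (s t) t).1 l) T := by
    intro T l
    have := fun i => congrFun (congrArg Prod.fst (hx i T)) l
    simp only [Prod.smul_fst, Pi.smul_apply, smul_eq_mul, Prod.fst_sum, Finset.sum_apply] at this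
    simp_rw [this, timeAvg]
    rw [← Finset.mul_sum, Finset.sum_comm]
    simp
  have hx2 : ∀ T j, ∑ i, freq s T i * (x i T).2 j = timeAvg (fun t => (γ (s t) t).2 j) T := by
    intro T j
    have := fun i => congrFun (congrArg Prod.snd (hx i T)) j
    simp only [Prod.smul_snd, Pi.smul_apply, smul_eq_mul, Prod.snd_sum, Finset.sum_apply] at this
    simp_rw [this, timeAvg]
    rw [← Finset.mul_sum, Finset.sum_comm]
    simp
  have hlim : ∀ i, ∃ y ∈ K i, Tendsto (x i) 𝒰 (𝓝 y) := fun i =>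
    (hKc i).ultrafilter_le_nhds' (𝒰.map (x i)) (mem_map.2 (univ_mem' (hxK i)))
  choose y hyK hy using hlim
  obtain ⟨π, hπ, hπlim⟩ : ∃ π ∈ stdSimplex ℝ (Fin n), Tendsto (freq s) 𝒰 (𝓝 π) := by
    refine (isCompact_stdSimplex ℝ (Fin n)).ultrafilter_le_nhds' (𝒰.map (freq s)) (mem_map.2 ?_)
    filter_upwards [h𝒰top (eventually_ge_atTop 1)] with T hT
    exact ⟨freq_nonneg s T, sum_freq s hT⟩
  have hπi := tendsto_pi_nhds.1 hπlim
  have hc : ∀ l, Tendsto (timeAvg (c l)) 𝒰 (𝓝 (∑ i, π i * (y i).1 l)) := by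
    intro l
    have h1 : Tendsto (fun T => ∑ i, freq s T i * (x i T).1 l) 𝒰
        (𝓝 (∑ i, π i * (y i).1 l)) :=
      tendsto_finsetSum _ fun i _ => (hπi i).mul
        (tendsto_pi_nhds.1 ((continuous_fst.tendsto _).comp (hy i)) l)
    have h2 := ((hcost l).mono_left h𝒰top).add h1
    rw [zero_add] at h2
    refine h2.congr fun T => ?_
    rw [hx1, timeAvg_sub, sub_add_cancel]
  refine ⟨⟨π, fun i => (y i).1, fun i => (y i).2⟩, fun j => ?_, fun l => ?_, hπ, hyK, ?_⟩
  · have h1 : Tendsto (fun T => ∑ i, freq s T i * (x i T).2 j) 𝒰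
        (𝓝 (∑ i, π i * (y i).2 j)) :=
      tendsto_finsetSum _ fun i _ => (hπi i).mul
        (tendsto_pi_nhds.1 ((continuous_snd.tendsto _).comp (hy i)) j)
    have h2 := ((hprob j).mono_left h𝒰top).add h1
    have h3 : Tendsto (fun T => timeAvg (fun t => if s (t + 1) = j then (1 : ℝ) else 0) T
        - freq s T j) atTop (𝓝 0) :=
      -- The transition averages count visits to $j$ at times $1,\dots,T$, the frequency those at
      -- $0,\dots,T-1$; the two agree in the limit, which gives balance.
      tendsto_timeAvg_succ_sub (x := fun t => if s t = j then (1 : ℝ) else 0) (C := 1)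
        fun t => by split_ifs <;> simp
    have h4 := h2.sub (h3.mono_left h𝒰top)
    rw [zero_add, sub_zero] at h4
    refine tendsto_nhds_unique (hπi j) (h4.congr fun T => ?_)
    rw [hx2, timeAvg_sub]
    ring
  · refine le_of_forall_pos_le_add fun δ hδ => ?_
    rw [zero_add]
    refine le_of_tendsto (hc l.succ) (h𝒰top ?_)
    have := eventually_lt_of_limsup_lt ((hcon l).trans_lt hδ)
      (isBoundedUnder_le_of_abs_le (abs_timeAvg_le (hC l.succ)))
    exact this.mono fun T hT => hT.le
  · exact le_of_tendsto (hc 0) (h𝒰b.mono fun T hT => hT.le)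

end Pathwise

-- Independence of fresh noise and past

section Noise

variable {𝓦 : Type uW} [MeasurableSpace 𝓦] {Ω : Type uΩ} [MeasurableSpace Ω] {P : Measure Ω}

/-- The joint law of `(W(t), U(t))`. -/
noncomputable def Noise.law (N : Noise P 𝓦) : Measure (𝓦 × unitInterval) :=
  (P.map (N.W 0)).prod volume

/-- The fresh randomness `((W(t), U(t)), V(t))` of slot `t`. -/
def Noise.drive (N : Noise P 𝓦) (t : ℕ) (ω : Ω) : (𝓦 × unitInterval) × unitInterval :=
  ((N.W t ω, N.U t ω), N.V t ω)

/-- The σ-algebras generated by the single noise variables. -/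
@[reducible] def Noise.sig (N : Noise P 𝓦) : ℕ ⊕ ℕ ⊕ ℕ → MeasurableSpace Ω :=
  Sum.elim (fun t => MeasurableSpace.comap (N.W t) inferInstance)
    (Sum.elim (fun t => MeasurableSpace.comap (N.U t) inferInstance)
      (fun t => MeasurableSpace.comap (N.V t) inferInstance))

/-- The slot of a noise variable. -/
def slot : ℕ ⊕ ℕ ⊕ ℕ → ℕ := Sum.elim id (Sum.elim id id)

/-- The σ-algebra generated by all the noise variables whose slot lies in `s`. -/
@[reducible] def Noise.sigAlg (N : Noise P 𝓦) (s : Set ℕ) : MeasurableSpace Ω :=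
  ⨆ x ∈ slot ⁻¹' s, N.sig x

theorem Noise.sig_le (N : Noise P 𝓦) (x : ℕ ⊕ ℕ ⊕ ℕ) : N.sig x ≤ ‹MeasurableSpace Ω› := by
  rcases x with t | t | t
  · exact (N.measurable_W t).comap_le
  · exact (N.measurable_U t).comap_le
  · exact (N.measurable_V t).comap_le

theorem Noise.sigAlg_le (N : Noise P 𝓦) (s : Set ℕ) : N.sigAlg s ≤ ‹MeasurableSpace Ω› :=
  iSup₂_le fun x _ => N.sig_le x

theorem Noise.sigAlg_mono (N : Noise P 𝓦) {s s' : Set ℕ} (h : s ⊆ s') :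
    N.sigAlg s ≤ N.sigAlg s' :=
  biSup_mono fun _ hx => h hx

theorem Noise.measurable_drive_sigAlg (N : Noise P 𝓦) {s : Set ℕ} {t : ℕ} (ht : t ∈ s) :
    Measurable[N.sigAlg s] (N.drive t) := by
  have h : ∀ x, slot x = t → N.sig x ≤ N.sigAlg s := fun x hx =>
    le_iSup₂_of_le x (show slot x ∈ s from hx ▸ ht) le_rfl
  refine Measurable.prodMk (Measurable.prodMk ?_ ?_) ?_
  · exact measurable_iff_comap_le.2 (h (Sum.inl t) rfl)
  · exact measurable_iff_comap_le.2 (h (Sum.inr (Sum.inl t)) rfl)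
  · exact measurable_iff_comap_le.2 (h (Sum.inr (Sum.inr t)) rfl)

theorem Noise.measurable_drive (N : Noise P 𝓦) (t : ℕ) : Measurable (N.drive t) :=
  (N.measurable_drive_sigAlg (Set.mem_singleton t)).mono (N.sigAlg_le _) le_rfl

/-- Slot $t$ and the earlier slots use disjoint sets of indices of one independent family. -/
theorem Noise.indepFun_drive (N : Noise P 𝓦) {t : ℕ} {𝓨 : Type*} [MeasurableSpace 𝓨]
    {Y : Ω → 𝓨} (hY : Measurable[N.sigAlg (Set.Iio t)] Y) : IndepFun (N.drive t) Y P := by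
  have hd : Disjoint (slot ⁻¹' {t}) (slot ⁻¹' Set.Iio t) :=
    Disjoint.preimage _ (by simp)
  exact (IndepFun_iff_Indep _ _ _).2 <| indep_of_indep_of_le
    (indep_iSup_of_disjoint N.sig_le N.indep hd)
    (measurable_iff_comap_le.1 (N.measurable_drive_sigAlg (Set.mem_singleton t)))
    (measurable_iff_comap_le.1 hY)

variable [IsProbabilityMeasure P]

instance (N : Noise P 𝓦) : IsProbabilityMeasure (P.map (N.W 0)) :=
  Measure.isProbabilityMeasure_map (N.measurable_W 0).aemeasurable

instance (N : Noise P 𝓦) : IsProbabilityMeasure N.law := by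
  unfold Noise.law; infer_instance

theorem Noise.map_prodMk_W_U (N : Noise P 𝓦) (t : ℕ) :
    P.map (fun ω => (N.W t ω, N.U t ω)) = N.law := by
  have h : IndepFun (N.W t) (N.U t) P := (IndepFun_iff_Indep _ _ _).2
    (N.indep.indep (i := Sum.inl t) (j := Sum.inr (Sum.inl t)) (by simp))
  rw [h.map_prod_eq_prod_map_map (N.measurable_W t).aemeasurable (N.measurable_U t).aemeasurable,
    N.map_U, (N.identDistrib_W t).map_eq, Noise.law]

theorem Noise.map_drive (N : Noise P 𝓦) (t : ℕ) :
    P.map (N.drive t) = N.law.prod volume := by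
  have hd : Disjoint ({Sum.inl t, Sum.inr (Sum.inl t)} : Set (ℕ ⊕ ℕ ⊕ ℕ))
      {Sum.inr (Sum.inr t)} := by simp
  have h : IndepFun (fun ω => (N.W t ω, N.U t ω)) (N.V t) P := by
    refine (IndepFun_iff_Indep _ _ _).2 <| indep_of_indep_of_le
      (indep_iSup_of_disjoint N.sig_le N.indep hd) (measurable_iff_comap_le.1 ?_) ?_
    · refine Measurable.prodMk (measurable_iff_comap_le.2 ?_) (measurable_iff_comap_le.2 ?_)
      · exact le_iSup₂_of_le (f := fun x _ => N.sig x) (Sum.inl t) (by simp) le_rfl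
      · exact le_iSup₂_of_le (f := fun x _ => N.sig x) (Sum.inr (Sum.inl t)) (by simp) le_rfl
    · exact le_iSup₂_of_le (f := fun x _ => N.sig x) (Sum.inr (Sum.inr t)) (by simp) le_rfl
  have hm := h.map_prod_eq_prod_map_map
    ((N.measurable_W t).prodMk (N.measurable_U t)).aemeasurable (N.measurable_V t).aemeasurable
  rw [N.map_V, N.map_prodMk_W_U] at hm
  exact hm

/-- A function of the fresh randomness and of the past which has mean zero for each frozen value
of the past has mean zero. -/
theorem Noise.integral_drive_eq_zero (N : Noise P 𝓦) {t : ℕ} {𝓨 : Type*} [MeasurableSpace 𝓨]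
    {Y : Ω → 𝓨} (hY : Measurable[N.sigAlg (Set.Iio t)] Y)
    {Φ : ((𝓦 × unitInterval) × unitInterval) × 𝓨 → ℝ} (hΦ : Measurable Φ)
    (hint : Integrable (fun ω => Φ (N.drive t ω, Y ω)) P)
    (hzero : ∀ y, ∫ z, Φ (z, y) ∂(N.law.prod volume) = 0) :
    ∫ ω, Φ (N.drive t ω, Y ω) ∂P = 0 := by
  have hYm : Measurable Y := hY.mono (N.sigAlg_le _) le_rfl
  have hYP : IsProbabilityMeasure (P.map Y) := Measure.isProbabilityMeasure_map hYm.aemeasurable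
  have hpair : Measurable fun ω => (N.drive t ω, Y ω) := (N.measurable_drive t).prodMk hYm
  have hmap : P.map (fun ω => (N.drive t ω, Y ω)) = (N.law.prod volume).prod (P.map Y) := by
    rw [(N.indepFun_drive hY).map_prod_eq_prod_map_map (N.measurable_drive t).aemeasurable
      hYm.aemeasurable, N.map_drive]
  have hint' : Integrable Φ ((N.law.prod volume).prod (P.map Y)) := by
    rw [← hmap]
    exact (integrable_map_measure hΦ.aestronglyMeasurable hpair.aemeasurable).2 hint
  -- The joint law of fresh noise and past is a product, so Fubini allows integrating the fresh
  -- noise first, for a frozen past.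
  rw [← integral_map (f := Φ) hpair.aemeasurable hΦ.aestronglyMeasurable, hmap,
    integral_prod_symm _ hint']
  simp [hzero]

/-- Strong law of large numbers for bounded functions of the fresh randomness and of the past
which have mean zero given the past. -/
theorem Noise.ae_tendsto_timeAvg (N : Noise P 𝓦) {𝓨 : ℕ → Type*} [∀ t, MeasurableSpace (𝓨 t)]
    {Y : (t : ℕ) → Ω → 𝓨 t} (hY : ∀ t, Measurable[N.sigAlg (Set.Iio t)] (Y t))
    {Φ : (t : ℕ) → ((𝓦 × unitInterval) × unitInterval) × 𝓨 t → ℝ} (hΦ : ∀ t, Measurable (Φ t))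
    {C : ℝ} (hC : ∀ t x, |Φ t x| ≤ C)
    (hzero : ∀ t y, ∫ z, Φ t (z, y) ∂(N.law.prod volume) = 0) :
    ∀ᵐ ω ∂P, Tendsto (timeAvg fun t => Φ t (N.drive t ω, Y t ω)) atTop (𝓝 0) := by
  have hYm : ∀ t, Measurable (Y t) := fun t => (hY t).mono (N.sigAlg_le _) le_rfl
  have hX : ∀ t, Measurable fun ω => Φ t (N.drive t ω, Y t ω) := fun t =>
    (hΦ t).comp ((N.measurable_drive t).prodMk (hYm t))
  refine ae_tendsto_timeAvg_of_orthogonal hX (fun t ω => hC t _) fun s t hst => ?_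
  have hXs : Measurable[N.sigAlg (Set.Iio t)] fun ω => Φ s (N.drive s ω, Y s ω) :=
    (hΦ s).comp ((N.measurable_drive_sigAlg (Set.mem_Iio.2 hst)).prodMk
      ((hY s).mono (N.sigAlg_mono (Set.Iio_subset_Iio hst.le)) le_rfl))
  -- The earlier term belongs to the past of slot $t$. Adjoined to `Y t`, it becomes a constant
  -- factor once the past is frozen.
  refine N.integral_drive_eq_zero (Y := fun ω => (Y t ω, Φ s (N.drive s ω, Y s ω)))
    (Φ := fun x => x.2.2 * Φ t (x.1, x.2.1)) ((hY t).prodMk hXs) ?_ ?_ ?_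
  · exact measurable_snd.snd.mul
      ((hΦ t).comp (measurable_fst.prodMk measurable_snd.fst))
  · refine Integrable.of_bound ((hX s).mul (hX t)).aestronglyMeasurable (C * C)
      (ae_of_all _ fun ω => ?_)
    rw [Real.norm_eq_abs, abs_mul]
    exact mul_le_mul (hC _ _) (hC _ _) (abs_nonneg _)
      ((abs_nonneg _).trans (hC s (N.drive s ω, Y s ω)))
  · rintro ⟨y, d⟩
    simp only
    rw [integral_const_mul, hzero, mul_zero]

end Noise

-- Compactness and convexity of the one-slot mean vectors

section Gam

variable {n k : ℕ} {𝓦 : Type uW} [MeasurableSpace 𝓦]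
  {𝓐 : Fin n → Type uA} [∀ i, MeasurableSpace (𝓐 i)]
  {Ω : Type uΩ} [MeasurableSpace Ω] {P : Measure Ω} [IsProbabilityMeasure P]

/-- The vector of mean costs and mean transition probabilities of a randomized action rule in
the basic state `i`. -/
noncomputable def meanVec (M : Model n k 𝓦 𝓐) (N : Noise P 𝓦) (i : Fin n)
    (a : 𝓦 × unitInterval → 𝓐 i) : (Fin (k + 1) → ℝ) × (Fin n → ℝ) :=
  (fun l => ∫ z, M.cost i l z.1 (a z) ∂N.law, fun j => ∫ z, M.prob i j z.1 (a z) ∂N.law)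

theorem Model.prob_le_one (M : Model n k 𝓦 𝓐) (i j : Fin n) (w : 𝓦) (a : 𝓐 i) :
    M.prob i j w a ≤ 1 := by
  rw [← M.sum_prob i w a]
  exact Finset.single_le_sum (fun j _ => M.prob_nonneg i j w a) (Finset.mem_univ j)

theorem Model.abs_prob_le_one (M : Model n k 𝓦 𝓐) (i j : Fin n) (w : 𝓦) (a : 𝓐 i) :
    |M.prob i j w a| ≤ 1 :=
  abs_le.2 ⟨by linarith [M.prob_nonneg i j w a], M.prob_le_one i j w a⟩

theorem mem_Gam_iff (M : Model n k 𝓦 𝓐) (N : Noise P 𝓦) (i : Fin n)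
    (x : (Fin (k + 1) → ℝ) × (Fin n → ℝ)) :
    x ∈ Gam M N i ↔ ∃ a : 𝓦 × unitInterval → 𝓐 i, Measurable a ∧ x = meanVec M N i a := by
  have hpair : AEMeasurable (fun ω => (N.W 0 ω, N.U 0 ω)) P :=
    ((N.measurable_W 0).prodMk (N.measurable_U 0)).aemeasurable
  refine exists_congr fun a => and_congr_right fun ha => ?_
  have hc : ∀ l, ∫ ω, M.cost i l (N.W 0 ω) (a (N.W 0 ω, N.U 0 ω)) ∂P =
      ∫ z, M.cost i l z.1 (a z) ∂N.law := fun l => by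
    rw [← N.map_prodMk_W_U 0, integral_map hpair]
    exact ((M.measurable_cost i l).comp (measurable_fst.prodMk ha)).aestronglyMeasurable
  have hp : ∀ j, ∫ ω, M.prob i j (N.W 0 ω) (a (N.W 0 ω, N.U 0 ω)) ∂P =
      ∫ z, M.prob i j z.1 (a z) ∂N.law := fun j => by
    rw [← N.map_prodMk_W_U 0, integral_map hpair]
    exact ((M.measurable_prob i j).comp (measurable_fst.prodMk ha)).aestronglyMeasurable
  simp only [hc, hp, meanVec]

theorem abs_integral_le_of_abs_le {α : Type*} [MeasurableSpace α] {μ : Measure α}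
    [IsProbabilityMeasure μ] {f : α → ℝ} {C : ℝ} (h : ∀ x, |f x| ≤ C) : |∫ x, f x ∂μ| ≤ C := by
  simpa using norm_integral_le_of_norm_le_const (μ := μ) (f := f) (ae_of_all _ h)

theorem abs_meanVec_fst_le (M : Model n k 𝓦 𝓐) (N : Noise P 𝓦) (i : Fin n)
    (a : 𝓦 × unitInterval → 𝓐 i) (l : Fin (k + 1)) : |(meanVec M N i a).1 l| ≤ M.cmax :=
  abs_integral_le_of_abs_le fun z => M.abs_cost_le i l z.1 (a z)

theorem abs_meanVec_snd_le (M : Model n k 𝓦 𝓐) (N : Noise P 𝓦) (i : Fin n)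
    (a : 𝓦 × unitInterval → 𝓐 i) (j : Fin n) : |(meanVec M N i a).2 j| ≤ 1 :=
  abs_integral_le_of_abs_le fun z => M.abs_prob_le_one i j z.1 (a z)

theorem closure_Gam_subset_closedBall (M : Model n k 𝓦 𝓐) (N : Noise P 𝓦) (i : Fin n) :
    closure (Gam M N i) ⊆ Metric.closedBall 0 (max M.cmax 1) := by
  refine closure_minimal (fun x hx => ?_) Metric.isClosed_closedBall
  obtain ⟨a, -, rfl⟩ := (mem_Gam_iff M N i x).1 hx
  have h0 : 0 ≤ max M.cmax 1 := zero_le_one.trans (le_max_right _ _)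
  rw [mem_closedBall_zero_iff, norm_prod_le_iff, pi_norm_le_iff_of_nonneg h0,
    pi_norm_le_iff_of_nonneg h0]
  exact ⟨fun l => (abs_meanVec_fst_le M N i a l).trans (le_max_left _ _),
    fun j => (abs_meanVec_snd_le M N i a j).trans (le_max_right _ _)⟩

theorem isCompact_closure_Gam (M : Model n k 𝓦 𝓐) (N : Noise P 𝓦) (i : Fin n) :
    IsCompact (closure (Gam M N i)) :=
  Metric.isCompact_of_isClosed_isBounded isClosed_closure
    (Metric.isBounded_closedBall.subset (closure_Gam_subset_closedBall M N i))

/-- A biased coin together with a uniform variable can be extracted from one uniform variable. -/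
theorem exists_measurable_bool_prod_unitInterval {p q : ℝ} (hp : 0 ≤ p) (hq : 0 ≤ q)
    (hpq : p + q = 1) : ∃ f : unitInterval → Bool × unitInterval, Measurable f ∧
      ∀ (g : Bool × unitInterval → ℝ) (C : ℝ), Measurable g → (∀ y, |g y| ≤ C) →
        ∫ u, g (f u) ∂(volume : Measure unitInterval) =
          p * ∫ u, g (true, u) ∂(volume : Measure unitInterval) +
            q * ∫ u, g (false, u) ∂(volume : Measure unitInterval) := by
  have hpair : ∀ b : Bool, Measurable fun u : unitInterval => (b, u) :=
    fun b => measurable_const.prodMk measurable_id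
  set ν : Measure (Bool × unitInterval) :=
    ENNReal.ofReal p • (volume : Measure unitInterval).map (fun u => (true, u)) +
      ENNReal.ofReal q • (volume : Measure unitInterval).map (fun u => (false, u)) with hν
  have hprob : ∀ b : Bool,
      IsProbabilityMeasure ((volume : Measure unitInterval).map fun u => (b, u)) :=
    fun b => Measure.isProbabilityMeasure_map (hpair b).aemeasurable
  have : IsProbabilityMeasure ν := ⟨by
    have h1 := hprob true
    have h2 := hprob false
    simp only [hν, Measure.add_apply, Measure.smul_apply, smul_eq_mul, measure_univ, mul_one]
    rw [← ENNReal.ofReal_add hp hq, hpq, ENNReal.ofReal_one]⟩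
  -- The mixture `ν` is a probability measure on a standard Borel space, hence an image of the
  -- uniform law.
  obtain ⟨f, hf, hfν⟩ := ν.exists_measurable_map_eq
  refine ⟨f, hf, fun g C hg hC => ?_⟩
  have hgi : ∀ b : Bool, Integrable g ((volume : Measure unitInterval).map fun u => (b, u)) :=
    fun b => have := hprob b
      Integrable.of_bound hg.aestronglyMeasurable C (ae_of_all _ hC)
  rw [← integral_map hf.aemeasurable hg.aestronglyMeasurable, hfν, hν,
    integral_add_measure ((hgi true).smul_measure ENNReal.ofReal_ne_top)
      ((hgi false).smul_measure ENNReal.ofReal_ne_top), integral_smul_measure,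
    integral_smul_measure, integral_map (hpair true).aemeasurable hg.aestronglyMeasurable,
    integral_map (hpair false).aemeasurable hg.aestronglyMeasurable,
    ENNReal.toReal_ofReal hp, ENNReal.toReal_ofReal hq, smul_eq_mul, smul_eq_mul]

/-- To mix two rules, split the uniform variable into a coin of bias $p$ and a new uniform variable,
and let the coin choose the rule. The coin does not depend on $w$, so the means mix linearly. -/
theorem convex_Gam (M : Model n k 𝓦 𝓐) (N : Noise P 𝓦) (i : Fin n) :
    Convex ℝ (Gam M N i) := by
  intro x hx y hy p q hp hq hpq
  obtain ⟨a, ha, rfl⟩ := (mem_Gam_iff M N i x).1 hx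
  obtain ⟨b, hb, rfl⟩ := (mem_Gam_iff M N i y).1 hy
  obtain ⟨f, hf, hfint⟩ := exists_measurable_bool_prod_unitInterval hp hq hpq
  set ab : 𝓦 × Bool × unitInterval → 𝓐 i :=
    fun z => if z.2.1 = true then a (z.1, z.2.2) else b (z.1, z.2.2) with hab
  have habm : Measurable ab := by
    refine Measurable.ite ?_ (by fun_prop) (by fun_prop)
    exact measurable_snd.fst (measurableSet_singleton true)
  have key : ∀ (F : 𝓦 → 𝓐 i → ℝ) (C : ℝ), Measurable (fun x : 𝓦 × 𝓐 i => F x.1 x.2) →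
      (∀ w a, |F w a| ≤ C) → p * ∫ z, F z.1 (a z) ∂N.law + q * ∫ z, F z.1 (b z) ∂N.law =
        ∫ z, F z.1 (ab (z.1, f z.2)) ∂N.law := by
    intro F C hF hC
    have hi : ∀ c : 𝓦 × unitInterval → 𝓐 i, Measurable c →
        Integrable (fun z : 𝓦 × unitInterval => F z.1 (c z)) N.law := fun c hc =>
      Integrable.of_bound (hF.comp (measurable_fst.prodMk hc)).aestronglyMeasurable C
        (ae_of_all _ fun z => hC _ _)
    have hia := hi a ha
    have hib := hi b hb
    have hif := hi (fun z => ab (z.1, f z.2)) (by fun_prop)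
    unfold Noise.law at hia hib hif ⊢
    rw [integral_prod _ hia, integral_prod _ hib, integral_prod _ hif, ← integral_const_mul,
      ← integral_const_mul, ← integral_add (hia.integral_prod_left.const_mul _)
        (hib.integral_prod_left.const_mul _)]
    refine integral_congr_ae (ae_of_all _ fun w => ?_)
    have := hfint (fun y => F w (ab (w, y))) C
      (hF.comp (measurable_const.prodMk (habm.comp (measurable_const.prodMk measurable_id))))
      fun y => hC _ _
    simpa [hab] using this.symm
  refine (mem_Gam_iff M N i _).2 ⟨fun z => ab (z.1, f z.2), by fun_prop, ?_⟩
  refine Prod.ext (funext fun l => ?_) (funext fun j => ?_)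
  · exact key (M.cost i l) M.cmax (M.measurable_cost i l) (M.abs_cost_le i l)
  · exact key (M.prob i j) 1 (M.measurable_prob i j) (M.abs_prob_le_one i j)

end Gam

-- The controlled process and the pathwise converse

section Converse

variable {n k : ℕ} {𝓦 : Type uW} [MeasurableSpace 𝓦]
  {𝓐 : Fin n → Type uA} [∀ i, MeasurableSpace (𝓐 i)]
  {Ω : Type uΩ} [MeasurableSpace Ω] {P : Measure Ω}

/-- The action chosen in slot `t` and state `i`, as a function of `(W(t), U(t))` for a frozen
history. -/
def Policy.rule (α : Policy n 𝓦 𝓐) (t : ℕ) (h : Hist n 𝓦 t) (i : Fin n)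
    (z : 𝓦 × unitInterval) : 𝓐 i :=
  α.act t (z.1, z.2, h) i

theorem Policy.measurable_rule (α : Policy n 𝓦 𝓐) (t : ℕ) (i : Fin n) :
    Measurable fun x : (𝓦 × unitInterval) × Hist n 𝓦 t => α.rule t x.2 i x.1 :=
  (measurable_pi_apply i).comp ((α.measurable_act t).comp
    (measurable_fst.fst.prodMk (measurable_fst.snd.prodMk measurable_snd)))

theorem Policy.measurable_rule_left (α : Policy n 𝓦 𝓐) (t : ℕ) (h : Hist n 𝓦 t) (i : Fin n) :
    Measurable (α.rule t h i) :=
  (α.measurable_rule t i).comp (measurable_id.prodMk measurable_const)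

/-- The next state as a function of the fresh randomness, the history and the current state. -/
def nextState (M : Model n k 𝓦 𝓐) (ψ : Sampler n) (α : Policy n 𝓦 𝓐) (t : ℕ)
    (x : ((𝓦 × unitInterval) × unitInterval) × Hist n 𝓦 t × Fin n) : Fin n :=
  ψ.toFun (M.row x.2.2 x.1.1.1 (α.rule t x.2.1 x.2.2 x.1.1)) x.1.2

/-- The action space varies with the state, so measurability is natural only for a fixed state;
finitely many states allow gluing. -/
theorem measurable_of_forall_state {t : ℕ} {β : Type*} [MeasurableSpace β]
    {Φ : ((𝓦 × unitInterval) × unitInterval) × Hist n 𝓦 t × Fin n → β}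
    (h : ∀ i, Measurable fun x : ((𝓦 × unitInterval) × unitInterval) × Hist n 𝓦 t =>
      Φ (x.1, x.2, i)) : Measurable Φ := by
  have h1 : Measurable fun y : (((𝓦 × unitInterval) × unitInterval) × Hist n 𝓦 t) × Fin n =>
      Φ (y.1.1, y.1.2, y.2) := measurable_from_prod_countable_left h
  exact h1.comp ((measurable_fst.prodMk measurable_snd.fst).prodMk measurable_snd.snd)

theorem measurable_nextState (M : Model n k 𝓦 𝓐) (ψ : Sampler n) (α : Policy n 𝓦 𝓐) (t : ℕ) :
    Measurable (nextState M ψ α t) := by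
  refine measurable_of_forall_state fun i => ψ.measurable_toFun.comp (Measurable.prodMk ?_
    measurable_fst.snd)
  refine Measurable.subtype_mk (measurable_pi_lambda _ fun j => ?_)
  exact (M.measurable_prob i j).comp (measurable_fst.fst.fst.prodMk
    ((α.measurable_rule t i).comp (measurable_fst.fst.prodMk measurable_snd)))

variable (M : Model n k 𝓦 𝓐) (ψ : Sampler n) (N : Noise P 𝓦) (s₀ : Fin n)
  (α : Policy n 𝓦 𝓐)

theorem state_succ_eq_nextState (t : ℕ) (ω : Ω) : state M ψ N s₀ α (t + 1) ω =
    nextState M ψ α t (N.drive t ω, history M ψ N s₀ α t ω, state M ψ N s₀ α t ω) :=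
  state_succ M ψ N s₀ α t ω

theorem measurable_history_of_state {u : Set ℕ} {t : ℕ}
    (hs : ∀ r < t, Measurable[N.sigAlg u] (state M ψ N s₀ α r))
    (hd : ∀ r < t, Measurable[N.sigAlg u] (N.drive r)) :
    Measurable[N.sigAlg u] (history M ψ N s₀ α t) := by
  have h1 : Measurable[N.sigAlg u] fun ω (r : Fin t) => state M ψ N s₀ α r.1 ω :=
    @measurable_pi_lambda _ _ _ (N.sigAlg u) _ _ fun r => hs r r.2
  have h2 : Measurable[N.sigAlg u] fun ω (r : Fin t) => N.W r.1 ω :=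
    @measurable_pi_lambda _ _ _ (N.sigAlg u) _ _ fun r => (hd r r.2).fst.fst
  have h3 : Measurable[N.sigAlg u] fun ω (r : Fin t) => N.U r.1 ω :=
    @measurable_pi_lambda _ _ _ (N.sigAlg u) _ _ fun r => (hd r r.2).fst.snd
  exact h1.prodMk (h2.prodMk h3)

/-- `V t` first enters in $S(t+1)$, so $S(t)$ depends only on noise strictly before $t$ and is
independent of the noise of slot $t$. -/
theorem measurable_state_sigAlg (t : ℕ) :
    Measurable[N.sigAlg (Set.Iio t)] (state M ψ N s₀ α t) := by
  induction t using Nat.strong_induction_on with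
  | _ t ih =>
    rcases t with _ | t
    · have : state M ψ N s₀ α 0 = fun _ => s₀ := funext (state_zero M ψ N s₀ α)
      rw [this]
      exact measurable_const
    · have hs : ∀ r < t + 1, Measurable[N.sigAlg (Set.Iio (t + 1))] (state M ψ N s₀ α r) :=
        fun r hr => (ih r hr).mono (N.sigAlg_mono (Set.Iio_subset_Iio hr.le)) le_rfl
      have hd : ∀ r < t + 1, Measurable[N.sigAlg (Set.Iio (t + 1))] (N.drive r) :=
        fun r hr => N.measurable_drive_sigAlg (Set.mem_Iio.2 hr)
      rw [funext (state_succ_eq_nextState M ψ N s₀ α t)]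
      exact (measurable_nextState M ψ α t).comp ((hd t t.lt_succ_self).prodMk
        ((measurable_history_of_state M ψ N s₀ α (fun r hr => hs r (hr.trans t.lt_succ_self))
          fun r hr => hd r (hr.trans t.lt_succ_self)).prodMk (hs t t.lt_succ_self)))

theorem measurable_history_state_sigAlg (t : ℕ) : Measurable[N.sigAlg (Set.Iio t)]
    fun ω => (history M ψ N s₀ α t ω, state M ψ N s₀ α t ω) :=
  (measurable_history_of_state M ψ N s₀ α
    (fun r hr => (measurable_state_sigAlg M ψ N s₀ α r).mono
      (N.sigAlg_mono (Set.Iio_subset_Iio hr.le)) le_rfl)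
    fun _ hr => N.measurable_drive_sigAlg (Set.mem_Iio.2 hr)).prodMk
      (measurable_state_sigAlg M ψ N s₀ α t)

/-- The cost as a function of the fresh randomness, the history and the current state. -/
def stepCost (l : Fin (k + 1)) (t : ℕ)
    (x : ((𝓦 × unitInterval) × unitInterval) × Hist n 𝓦 t × Fin n) : ℝ :=
  M.cost x.2.2 l x.1.1.1 (α.rule t x.2.1 x.2.2 x.1.1)

theorem measurable_stepCost (l : Fin (k + 1)) (t : ℕ) : Measurable (stepCost M α l t) :=
  measurable_of_forall_state fun i => (M.measurable_cost i l).comp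
    (measurable_fst.fst.fst.prodMk
      ((α.measurable_rule t i).comp (measurable_fst.fst.prodMk measurable_snd)))

theorem costProc_eq_stepCost (l : Fin (k + 1)) (t : ℕ) (ω : Ω) : costProc M ψ N s₀ α l t ω =
    stepCost M α l t (N.drive t ω, history M ψ N s₀ α t ω, state M ψ N s₀ α t ω) := by
  simp [costProc, stepCost, action, Policy.rule, Noise.drive]

theorem measurable_costProc (l : Fin (k + 1)) (t : ℕ) :
    Measurable (costProc M ψ N s₀ α l t) := by
  rw [funext (costProc_eq_stepCost M ψ N s₀ α l t)]
  exact (measurable_stepCost M α l t).comp ((N.measurable_drive t).prodMk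
    ((measurable_history_state_sigAlg M ψ N s₀ α t).mono (N.sigAlg_le _) le_rfl))

theorem abs_costProc_le (l : Fin (k + 1)) (t : ℕ) (ω : Ω) :
    |costProc M ψ N s₀ α l t ω| ≤ M.cmax := by
  rw [costProc_eq_stepCost]
  exact M.abs_cost_le _ _ _ _

variable [IsProbabilityMeasure P]

theorem measurable_meanVec_fst (l : Fin (k + 1)) (t : ℕ) :
    Measurable fun x : ((𝓦 × unitInterval) × unitInterval) × Hist n 𝓦 t × Fin n =>
      (meanVec M N x.2.2 (α.rule t x.2.1 x.2.2)).1 l := by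
  refine measurable_of_forall_state fun i => ?_
  have h : StronglyMeasurable fun y : Hist n 𝓦 t × (𝓦 × unitInterval) =>
      M.cost i l y.2.1 (α.rule t y.1 i y.2) :=
    ((M.measurable_cost i l).comp (measurable_snd.fst.prodMk
      ((α.measurable_rule t i).comp measurable_swap))).stronglyMeasurable
  exact (h.integral_prod_right' (ν := N.law)).measurable.comp measurable_snd

theorem measurable_meanVec_snd (j : Fin n) (t : ℕ) :
    Measurable fun x : ((𝓦 × unitInterval) × unitInterval) × Hist n 𝓦 t × Fin n =>
      (meanVec M N x.2.2 (α.rule t x.2.1 x.2.2)).2 j := by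
  refine measurable_of_forall_state fun i => ?_
  have h : StronglyMeasurable fun y : Hist n 𝓦 t × (𝓦 × unitInterval) =>
      M.prob i j y.2.1 (α.rule t y.1 i y.2) :=
    ((M.measurable_prob i j).comp (measurable_snd.fst.prodMk
      ((α.measurable_rule t i).comp measurable_swap))).stronglyMeasurable
  exact (h.integral_prod_right' (ν := N.law)).measurable.comp measurable_snd

theorem integral_stepCost (l : Fin (k + 1)) (t : ℕ) (h : Hist n 𝓦 t) (i : Fin n) :
    ∫ z, stepCost M α l t (z, h, i) ∂(N.law.prod volume) =
      (meanVec M N i (α.rule t h i)).1 l := by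
  have := integral_fun_fst (μ := N.law) (ν := (volume : Measure unitInterval))
    fun z => M.cost i l z.1 (α.rule t h i z)
  simpa [stepCost, meanVec] using this

/-- Integrating over $V$ first, the sampler returns $p_{i,j}(w,a)$; integrating over $(W,U)$ then
gives its mean. -/
theorem integral_ite_nextState (j : Fin n) (t : ℕ) (h : Hist n 𝓦 t) (i : Fin n) :
    ∫ z, (if nextState M ψ α t (z, h, i) = j then (1 : ℝ) else 0) ∂(N.law.prod volume) =
      (meanVec M N i (α.rule t h i)).2 j := by
  have hm : Measurable fun z : (𝓦 × unitInterval) × unitInterval =>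
      if nextState M ψ α t (z, h, i) = j then (1 : ℝ) else 0 :=
    Measurable.ite ((measurable_nextState M ψ α t).comp
      (measurable_id.prodMk measurable_const) (measurableSet_singleton j))
      measurable_const measurable_const
  rw [integral_prod _ (Integrable.of_bound hm.aestronglyMeasurable 1 (ae_of_all _ fun z => by
    split_ifs <;> simp))]
  refine integral_congr_ae (ae_of_all _ fun z => ?_)
  have hset : MeasurableSet
      {v : unitInterval | ψ.toFun (M.row i z.1 (α.rule t h i z)) v = j} :=
    ψ.measurable_toFun.comp (measurable_const.prodMk measurable_id) (measurableSet_singleton j)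
  have h1 := integral_indicator_one (μ := (volume : Measure unitInterval)) hset
  rw [measureReal_def, ψ.volume_eq,
    ENNReal.toReal_ofReal ((M.row i z.1 (α.rule t h i z)).2.1 j)] at h1
  exact (integral_congr_ae (ae_of_all _ fun v => by
    simp only [Set.indicator_apply, nextState, Set.mem_ofPred_eq, Pi.one_apply]
    congr)).trans h1

theorem ae_tendsto_timeAvg_cost (l : Fin (k + 1)) : ∀ᵐ ω ∂P, Tendsto (timeAvg fun t =>
    costProc M ψ N s₀ α l t ω - (meanVec M N (state M ψ N s₀ α t ω)
      (α.rule t (history M ψ N s₀ α t ω) (state M ψ N s₀ α t ω))).1 l) atTop (𝓝 0) := by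
  simp_rw [costProc_eq_stepCost]
  refine N.ae_tendsto_timeAvg (measurable_history_state_sigAlg M ψ N s₀ α)
    (Φ := fun t x => stepCost M α l t x - (meanVec M N x.2.2 (α.rule t x.2.1 x.2.2)).1 l)
    (fun t => (measurable_stepCost M α l t).sub (measurable_meanVec_fst M N α l t))
    (C := M.cmax + M.cmax) (fun t x => ?_) ?_
  · exact (abs_sub _ _).trans (add_le_add (M.abs_cost_le _ _ _ _) (abs_meanVec_fst_le M N _ _ _))
  · rintro t ⟨h, i⟩
    simp only
    rw [integral_sub _ (integrable_const _), integral_stepCost]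
    · simp
    · exact Integrable.of_bound ((measurable_stepCost M α l t).comp
        (measurable_id.prodMk measurable_const)).aestronglyMeasurable M.cmax
        (ae_of_all _ fun z => M.abs_cost_le _ _ _ _)

theorem ae_tendsto_timeAvg_prob (j : Fin n) : ∀ᵐ ω ∂P, Tendsto (timeAvg fun t =>
    (if state M ψ N s₀ α (t + 1) ω = j then 1 else 0) - (meanVec M N (state M ψ N s₀ α t ω)
      (α.rule t (history M ψ N s₀ α t ω) (state M ψ N s₀ α t ω))).2 j) atTop (𝓝 0) := by
  have hm : ∀ t, Measurable fun x => if nextState M ψ α t x = j then (1 : ℝ) else 0 := fun t =>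
    Measurable.ite (measurable_nextState M ψ α t (measurableSet_singleton j))
      measurable_const measurable_const
  simp_rw [state_succ_eq_nextState]
  refine N.ae_tendsto_timeAvg (measurable_history_state_sigAlg M ψ N s₀ α)
    (Φ := fun t x => (if nextState M ψ α t x = j then (1 : ℝ) else 0) -
      (meanVec M N x.2.2 (α.rule t x.2.1 x.2.2)).2 j)
    (fun t => (hm t).sub (measurable_meanVec_snd M N α j t))
    (C := 1 + 1) (fun t x => ?_) ?_
  · refine (abs_sub _ _).trans (add_le_add ?_ (abs_meanVec_snd_le M N _ _ _))
    split_ifs <;> simp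
  · rintro t ⟨h, i⟩
    simp only
    rw [integral_sub _ (integrable_const _), integral_ite_nextState]
    · simp
    · exact Integrable.of_bound ((hm t).comp
        (measurable_id.prodMk measurable_const)).aestronglyMeasurable 1
        (ae_of_all _ fun z => by split_ifs <;> simp)

/-- Almost every path of a policy satisfying the constraints yields feasible points of the
deterministic problem whose objective is at most any given bound above the long-run cost. -/
theorem ae_exists_isFeasible (hα : SatisfiesConstraints M ψ N s₀ α) :
    ∀ᵐ ω ∂P, ∀ b, liminf (timeAvg fun t => costProc M ψ N s₀ α 0 t ω) atTop < b →
      ∃ x : DetVar n k, x.IsFeasible M N ∧ x.objective ≤ b := by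
  filter_upwards [hα, ae_all_iff.2 (ae_tendsto_timeAvg_cost M ψ N s₀ α),
    ae_all_iff.2 (ae_tendsto_timeAvg_prob M ψ N s₀ α)] with ω hcon hcost hprob b hb
  obtain ⟨x, h1, h2, h3, h4, h5⟩ := exists_detVar_of_path
    (isCompact_closure_Gam M N) (fun i => (convex_Gam M N i).closure)
    (s := fun t => state M ψ N s₀ α t ω)
    -- The rule is evaluated in every state $i$, visited or not, under the realized history.
    (γ := fun i t => meanVec M N i (α.rule t (history M ψ N s₀ α t ω) i))
    (fun i t => subset_closure ((mem_Gam_iff M N i _).2 ⟨_, α.measurable_rule_left t _ i, rfl⟩))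
    (fun l t => abs_costProc_le M ψ N s₀ α l t ω) hcost hprob hcon hb
  exact ⟨x, ⟨h1, h2, h3, h4⟩, h5⟩

/-- A real `sInf` is a lower bound only for sets bounded below; the ball containing
$\overline\Gamma_i$ supplies the bound. -/
theorem optCost_le_objective {x : DetVar n k} (hx : x.IsFeasible M N) :
    optCost M N ≤ x.objective := by
  refine csInf_le ⟨-max M.cmax 1, ?_⟩ ⟨x, hx, rfl⟩
  rintro _ ⟨y, hy, rfl⟩
  have hc : ∀ i, -max M.cmax 1 ≤ y.c i 0 := fun i => by
    have h1 := mem_closedBall_zero_iff.1 (closure_Gam_subset_closedBall M N i (hy.mem_closure i))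
    have h2 : |y.c i 0| ≤ max M.cmax 1 :=
      (norm_le_pi_norm (y.c i) 0).trans ((norm_fst_le (y.c i, y.p i)).trans h1)
    exact (abs_le.1 h2).1
  calc -max M.cmax 1 = ∑ i, y.π i * -max M.cmax 1 := by
        rw [← Finset.sum_mul, hy.mem_simplex.2, one_mul]
    _ ≤ ∑ i, y.π i * y.c i 0 :=
        Finset.sum_le_sum fun i _ => mul_le_mul_of_nonneg_left (hc i) (hy.mem_simplex.1 i)

theorem ae_optCost_le_liminf (hα : SatisfiesConstraints M ψ N s₀ α) :
    ∀ᵐ ω ∂P, optCost M N ≤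
      liminf (timeAvg fun t => costProc M ψ N s₀ α 0 t ω) atTop := by
  filter_upwards [ae_exists_isFeasible M ψ N s₀ α hα] with ω hω
  refine le_of_forall_gt_imp_ge_of_dense fun b hb => ?_
  obtain ⟨x, hx, hxb⟩ := hω b hb
  exact (optCost_le_objective M N hx).trans hxb

end Converse

/-- An almost sure lower bound on the lower limit of uniformly bounded random variables is a lower
bound on the lower limit of their expectations. -/
theorem le_liminf_integral_of_ae_le_liminf {Ω : Type*} [MeasurableSpace Ω] {P : Measure Ω}
    [IsProbabilityMeasure P] {f : ℕ → Ω → ℝ} {C L : ℝ} (hf : ∀ T, Measurable (f T))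
    (hC : ∀ T ω, |f T ω| ≤ C) (hL : ∀ᵐ ω ∂P, L ≤ liminf (fun T => f T ω) atTop) :
    L ≤ liminf (fun T => ∫ ω, f T ω ∂P) atTop := by
  have hgm : ∀ T, Measurable fun ω => max (L - f T ω) 0 := fun T =>
    (measurable_const.sub (hf T)).max measurable_const
  have hg : ∀ T ω, |max (L - f T ω) 0| ≤ |L| + C := fun T ω => by
    have := abs_le.1 (hC T ω)
    rw [abs_of_nonneg (le_max_right _ _)]
    exact max_le (by linarith [le_abs_self L])
      (add_nonneg (abs_nonneg _) ((abs_nonneg _).trans (hC T ω)))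
  -- The sequence itself need not converge, but its shortfall below `L` tends to zero almost surely,
  -- so dominated convergence applies to the positive part of `L - f T`.
  have hlim : Tendsto (fun T => ∫ ω, max (L - f T ω) 0 ∂P) atTop (𝓝 (∫ _, (0 : ℝ) ∂P)) := by
    refine tendsto_integral_of_dominated_convergence (fun _ => |L| + C)
      (fun T => (hgm T).aestronglyMeasurable) (integrable_const _)
      (fun T => ae_of_all _ (hg T)) ?_
    filter_upwards [hL] with ω hω
    refine Metric.tendsto_atTop'.2 fun ε hε => ?_
    have h := eventually_lt_of_lt_liminf ((sub_lt_self L hε).trans_le hω)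
      (isBoundedUnder_ge_of_abs_le fun T => hC T ω)
    obtain ⟨T₀, hT₀⟩ := eventually_atTop.1 h
    refine ⟨T₀, fun T hT => ?_⟩
    rw [Real.dist_eq, sub_zero, abs_of_nonneg (le_max_right _ _)]
    exact max_lt (by linarith [hT₀ T hT.le]) hε
  rw [integral_zero] at hlim
  have hEC : ∀ T, |∫ ω, f T ω ∂P| ≤ C := fun T => abs_integral_le_of_abs_le (hC T)
  refine le_of_forall_pos_sub_le fun ε hε => ?_
  refine le_liminf_of_le (isBoundedUnder_le_of_abs_le hEC).isCoboundedUnder_ge ?_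
  filter_upwards [hlim.eventually (gt_mem_nhds hε)] with T hT
  have hfi : Integrable (f T) P :=
    Integrable.of_bound (hf T).aestronglyMeasurable C (ae_of_all _ (hC T))
  have hmono := integral_mono ((integrable_const L).sub hfi)
    (Integrable.of_bound (hgm T).aestronglyMeasurable _ (ae_of_all _ (hg T)))
    fun ω => le_max_left (L - f T ω) 0
  have hsub : ∫ ω, (L - f T ω) ∂P = L - ∫ ω, f T ω ∂P := by
    rw [integral_sub (integrable_const L) hfi]
    simp
  simp only [Pi.sub_apply] at hmono
  linarith

end OppMDP

theorem mainTheorem1 {n k : ℕ} {𝓦 : Type*} [MeasurableSpace 𝓦]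
    {𝓐 : Fin n → Type*} [∀ i, MeasurableSpace (𝓐 i)] [∀ i, StandardBorelSpace (𝓐 i)]
    {Ω : Type*} [MeasurableSpace Ω] {P : Measure Ω} [IsProbabilityMeasure P]
    (M : OppMDP.Model n k 𝓦 𝓐) (ψ : OppMDP.Sampler n) (N : OppMDP.Noise P 𝓦) (s₀ : Fin n)
    (hfeas : OppMDP.StochasticFeasible M ψ N s₀) :
    OppMDP.DetFeasible M N ∧
    ∀ α : OppMDP.Policy n 𝓦 𝓐, OppMDP.SatisfiesConstraints M ψ N s₀ α →
      (∀ᵐ ω ∂P, OppMDP.optCost M N ≤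
        liminf (OppMDP.timeAvg fun t => OppMDP.costProc M ψ N s₀ α 0 t ω) atTop) ∧
      OppMDP.optCost M N ≤
        liminf (OppMDP.timeAvg fun t => ∫ ω, OppMDP.costProc M ψ N s₀ α 0 t ω ∂P) atTop := by
  refine ⟨?_, fun α hα => ⟨OppMDP.ae_optCost_le_liminf M ψ N s₀ α hα, ?_⟩⟩
  · obtain ⟨α, hα⟩ := hfeas
    obtain ⟨ω, hω⟩ := (OppMDP.ae_exists_isFeasible M ψ N s₀ α hα).exists
    -- Feasibility needs just one good path and any bound above its lower limit.
    obtain ⟨x, hx, -⟩ := hω _ (lt_add_one _)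
    exact ⟨x, hx⟩
  · have hmeas := OppMDP.measurable_costProc M ψ N s₀ α 0
    have hbound := OppMDP.abs_costProc_le M ψ N s₀ α 0
    have hE : (OppMDP.timeAvg fun t => ∫ ω, OppMDP.costProc M ψ N s₀ α 0 t ω ∂P) =
        fun T => ∫ ω, OppMDP.timeAvg (fun t => OppMDP.costProc M ψ N s₀ α 0 t ω) T ∂P := by
      funext T
      simp only [OppMDP.timeAvg]
      rw [integral_const_mul, integral_finsetSum _ fun t _ =>
        Integrable.of_bound (hmeas t).aestronglyMeasurable M.cmax (ae_of_all _ (hbound t))]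
    rw [hE]
    exact OppMDP.le_liminf_integral_of_ae_le_liminf
      (fun T => (Finset.measurable_sum _ fun t _ => hmeas t).const_mul _)
      (fun T ω => OppMDP.abs_timeAvg_le (fun t => hbound t ω) T)
      (OppMDP.ae_optCost_le_liminf M ψ N s₀ α hα)
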